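/- Let $X$ be a real reflexive Banach space with dual $X^*$ and dual norm $\|\cdot\|_*$, let $T$ be a non-empty set, let $\Phi_t:X\to\mathbb R\cup\{+\infty\}$ $(t\in T)$ be proper, convex and lower semicontinuous functions, and put $\Phi:=\sup_{t\in T}\Phi_t$. For $\varepsilon\ge 0$ and $\Phi_t(x)<+\infty$ let $$\partial_\varepsilon\Phi_t(x):=\{x^*\in X^* : \langle x^*,u-x\rangle\le\Phi_t(u)-\Phi_t(x)+\varepsilon\ \ \forall u\in X\}.$$ Then for every $\bar x\in X$ with $\Phi(\bar x)<+\infty$ and every $\delta\ge 0$, the $\delta$-normal set $$\mathrm N^{\delta}_{[\Phi\le\Phi(\bar x)]}(\bar x):=\{x^*\in X^* : \langle x^*,u-\bar x\rangle\le\delta\ \text{ for all } u\in X \text{ with } \Phi(u)\le\Phi(\bar x)\}$$ satisfies $$\mathrm N^{\delta}_{[\Phi\le\Phi(\bar x)]}(\bar x)=\|\cdot\|_*\text{-}\limsup_{\substack{\sum_{i=1}^k\mu_i(\Phi(\bar x)-\Phi_{t_i}(\bar x)+\varepsilon_i)\to\delta\\ \mu_i\ge 0,\ \varepsilon_i\ge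 0,\ t_i\in T,\ k\ge 1}}\ \sum_{i=1}^k\mu_i\,\partial_{\varepsilon_i}\Phi_{t_i}(\bar x).$$ Here the right-hand side is the Painlevé–Kuratowski upper limit in the norm topology of $X^*$, that is, the set of all $x^*\in X^*$ such that for every norm neighbourhood $W$ of $x^*$ and every $\eta>0$ there are $k\ge1$, $t_i\in T$, $\mu_i\ge0$ and $\varepsilon_i\ge0$ $(i=1,\dots,k)$ with $\left|\sum_{i=1}^k\mu_i(\Phi(\bar x)-\Phi_{t_i}(\bar x)+\varepsilon_i)-\delta\right|<\eta$ and $\left(\sum_{i=1}^k\mu_i\,\partial_{\varepsilon_i}\Phi_{t_i}(\bar x)\right)\cap W\ne\emptyset$ (Minkowski sums; $0\cdot\emptyset=\emptyset$). -/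

import Mathlib

open scoped Pointwise Topology

noncomputable section

namespace ConvexSublevel

/-- A normed space is reflexive if the canonical embedding into its bidual is onto. -/
def IsReflexiveSpace (X : Type*) [NormedAddCommGroup X] [NormedSpace ℝ X] : Prop :=
  Function.Surjective (NormedSpace.inclusionInDoubleDual ℝ X)

/-- The (effective) domain of an extended-real-valued function. -/
def effDom {X : Type*} (f : X → EReal) : Set X := {x | f x < ⊤}

/-- The epigraph, a subset of `X × ℝ`. -/
def epi {X : Type*} (f : X → EReal) : Set (X × ℝ) := {p | f p.1 ≤ (p.2 : EReal)}

/-- `f ∈ Γ₀(X)`: a function with values in `ℝ ∪ {+∞}` that is proper, convex (its epigraph is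
convex) and lower semicontinuous (its epigraph is closed). -/
structure IsGammaZero {X : Type*} [NormedAddCommGroup X] [NormedSpace ℝ X]
    (f : X → EReal) : Prop where
  ne_bot : ∀ x, f x ≠ ⊥
  proper : (effDom f).Nonempty
  convex : Convex ℝ (epi f)
  lsc : IsClosed (epi f)

/-- The sublevel set `[f ≤ r]`. -/
def sublevel {X : Type*} (f : X → EReal) (r : EReal) : Set X := {x | f x ≤ r}

/-- The `δ`-normal set `N_S^δ(x)`, as a subset of the topological dual. -/
def normalSet {X : Type*} [NormedAddCommGroup X] [NormedSpace ℝ X]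
    (δ : ℝ) (S : Set X) (x : X) : Set (StrongDual ℝ X) :=
  {xs | ∀ u ∈ S, xs (u - x) ≤ δ}

/-- The `ε`-subdifferential `∂_ε f(x)`; it is empty if `ε < 0` or `x ∉ dom f`. -/
def epsSubdiff {X : Type*} [NormedAddCommGroup X] [NormedSpace ℝ X]
    (ε : ℝ) (f : X → EReal) (x : X) : Set (StrongDual ℝ X) :=
  {xs | 0 ≤ ε ∧ x ∈ effDom f ∧
    ∀ u : X, ((xs (u - x) : ℝ) : EReal) ≤ f u - f x + (ε : EReal)}

/-- The Painlevé-Kuratowski upper limit of a multifunction `M` along a filter `l`: the points `v`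
such that for every neighbourhood `W` of `v` and every `Z ∈ l` there is `u ∈ Z` for which
`M u` meets `W`. The topology is the one of the instance on `V`. -/
def upperLimit {U V : Type*} [TopologicalSpace V] (l : Filter U) (M : U → Set V) : Set V :=
  {v | ∀ W ∈ 𝓝 v, ∀ Z ∈ l, ∃ u ∈ Z, (M u ∩ W).Nonempty}

/-- The parameters of the upper limit: a positive integer `k`, indices `t₁, …, t_k ∈ T`, and
numbers `μᵢ ≥ 0`, `εᵢ ≥ 0`. -/
structure Param (T : Type*) where
  k : ℕ
  k_pos : 1 ≤ k
  t : Fin k → T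
  μ : Fin k → ℝ
  ε : Fin k → ℝ
  μ_nonneg : ∀ i, 0 ≤ μ i
  ε_nonneg : ∀ i, 0 ≤ ε i

/-- The number `∑ᵢ μᵢ (Φ(x) - Φ_{tᵢ}(x) + εᵢ)`, where `Φ = sup_t Φ_t`. It is used only at points
`x` where `Φ` (hence each `Φ_t`) is finite, so that `toReal` is the actual value. -/
def Param.weight {X T : Type*} (Φ : T → X → EReal) (x : X) (p : Param T) : ℝ :=
  ∑ i, p.μ i * ((⨆ t, Φ t x).toReal - (Φ (p.t i) x).toReal + p.ε i)

/-- The Minkowski sum `∑ᵢ μᵢ ∂_{εᵢ} Φ_{tᵢ}(x)`. -/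
def Param.subdiffSum {X T : Type*} [NormedAddCommGroup X] [NormedSpace ℝ X]
    (Φ : T → X → EReal) (x : X) (p : Param T) : Set (StrongDual ℝ X) :=
  ∑ i, p.μ i • epsSubdiff (p.ε i) (Φ (p.t i)) x

end ConvexSublevel

end

/-!
Record every subgradient `v ∈ ∂_ε Φ_t(x̄)` together with its slack `w = Φ(x̄) - Φ_t(x̄) + ε`.
The pairs `(v, w)` are precisely the inequalities `⟨v, u - x̄⟩ ≤ w` coming from continuous
affine minorants of the `Φ_t`, so by the Fenchel–Moreau theorem they cut out the sublevel set
`[Φ ≤ Φ(x̄)]`. Hence `x*` is a `δ`-normal exactly when `⟨x*, u - x̄⟩ ≤ δ` is a consequence of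
this system of linear inequalities, which by the nonhomogeneous Farkas lemma means that
`(x*, δ)` lies in the closed convex cone generated by the pairs. Reflexivity enters here: the
separating functionals on `X* × ℝ` are given by points of `X × ℝ`, so that the closure may be
taken in norm. The points of the cone itself are the `(∑ μᵢ vᵢ, ∑ μᵢ wᵢ)`, and closing it is
taking the upper limit.
-/

namespace ConvexSublevel

open PointedCone (hull subset_hull)

theorem mem_upperLimit_comap_nhds {U V Y : Type*} [TopologicalSpace V] [TopologicalSpace Y]
    {f : U → Y} {M : U → Set V} {v : V} {y : Y} :
    v ∈ upperLimit (Filter.comap f (𝓝 y)) M ↔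
      (v, y) ∈ closure {q : V × Y | ∃ u, q.1 ∈ M u ∧ f u = q.2} := by
  rw [mem_closure_iff_nhds]
  constructor
  · intro h s hs
    obtain ⟨W, hW, N, hN, hWN⟩ := mem_nhds_prod_iff.1 hs
    obtain ⟨u, hu, w, hw, hwW⟩ := h W hW _ (Filter.preimage_mem_comap hN)
    exact ⟨(w, f u), hWN ⟨hwW, hu⟩, u, hw, rfl⟩
  · intro h W hW Z hZ
    obtain ⟨N, hN, hNZ⟩ := Filter.mem_comap.1 hZ
    obtain ⟨⟨w, _⟩, ⟨hwW, huN⟩, u, hw, rfl⟩ := h _ (prod_mem_nhds hW hN)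
    exact ⟨u, hNZ huN, w, hw, hwW⟩

section ConicHull

theorem exists_fin_succ_of_mem_hull {E : Type*} [AddCommGroup E] [Module ℝ E] {s : Set E}
    (hs : s.Nonempty) {x : E} (hx : x ∈ hull ℝ s) :
    ∃ (n : ℕ) (c : Fin (n + 1) → ℝ) (g : Fin (n + 1) → E),
      (∀ i, 0 ≤ c i) ∧ (∀ i, g i ∈ s) ∧ ∑ i, c i • g i = x := by
  obtain ⟨y, hy⟩ := hs
  obtain ⟨n, c, g, rfl⟩ := Submodule.mem_span_set'.1 hx
  refine ⟨n, Fin.cons 0 fun i => c i, Fin.cons y fun i => g i, ?_, ?_, ?_⟩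
  · exact Fin.cases le_rfl fun i => (c i).2
  · exact Fin.cases hy fun i => (g i).2
  · simp [Fin.sum_univ_succ]

variable {E : Type*} [AddCommGroup E] [Module ℝ E] [TopologicalSpace E] [ContinuousAdd E]
  [ContinuousSMul ℝ E]

theorem mem_closure_hull_of_forall_add_nsmul_mem {s : Set E} {x d : E}
    (h : ∀ n : ℕ, x + n • d ∈ s) : d ∈ closure (hull ℝ s : Set E) := by
  have hlim : Filter.Tendsto (fun n : ℕ => (1 / ((n : ℝ) + 1)) • x + d) Filter.atTop (𝓝 d) := by
    simpa using (tendsto_one_div_add_atTop_nhds_zero_nat (𝕜 := ℝ)).smul_const x |>.add_const d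
  refine mem_closure_of_tendsto hlim (.of_forall fun n => ?_)
  have hn : (n : ℝ) + 1 ≠ 0 := by positivity
  have hscale : (1 / ((n : ℝ) + 1)) • (x + (n + 1) • d) = (1 / ((n : ℝ) + 1)) • x + d := by
    rw [smul_add, ← Nat.cast_smul_eq_nsmul ℝ, smul_smul, Nat.cast_succ, one_div_mul_cancel hn,
      one_smul]
  rw [← hscale]
  exact (hull ℝ s).smul_mem (by positivity : (0 : ℝ) ≤ 1 / (n + 1)) (subset_hull (h (n + 1)))

theorem closure_hull_insert_eq {s : Set E} {d : E} (hd : d ∈ closure (hull ℝ s : Set E)) :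
    closure (hull ℝ (insert d s) : Set E) = closure (hull ℝ s : Set E) := by
  refine (closure_minimal ?_ isClosed_closure).antisymm
    (closure_mono (Submodule.span_mono (Set.subset_insert d s)))
  have hle : hull ℝ (insert d s) ≤ (hull ℝ s).topologicalClosure :=
    Submodule.span_le.2 (Set.insert_subset hd (subset_hull.trans subset_closure))
  exact hle

theorem mem_closure_hull_iff_forall_le_zero {F : Type*} [AddCommGroup F] [Module ℝ F]
    [TopologicalSpace F] [IsTopologicalAddGroup F] [ContinuousSMul ℝ F] [LocallyConvexSpace ℝ F]
    {s : Set F} {x : F} :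
    x ∈ closure (hull ℝ s : Set F) ↔ ∀ g : StrongDual ℝ F, (∀ y ∈ s, g y ≤ 0) → g x ≤ 0 := by
  constructor
  · intro hx g hg
    let C : ProperCone ℝ F := (ProperCone.positive ℝ ℝ).comap (-g)
    have hsC : hull ℝ s ≤ C.toPointedCone :=
      Submodule.span_le.2 fun y hy => neg_nonneg.2 (hg y hy)
    exact neg_nonneg.1 (closure_minimal hsC C.isClosed hx)
  · intro h
    by_contra hx
    let C : ProperCone ℝ F := ⟨(hull ℝ s).topologicalClosure, isClosed_closure⟩
    obtain ⟨g, hgC, hgx⟩ := C.hyperplane_separation_point (x₀ := x) hx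
    have hgs : ∀ y ∈ s, (-g) y ≤ 0 := fun y hy =>
      neg_nonpos.2 (hgC y (subset_closure (subset_hull hy)))
    exact (neg_nonpos.1 (h (-g) hgs)).not_gt hgx

end ConicHull

section Farkas

variable {X : Type*} [NormedAddCommGroup X] [NormedSpace ℝ X]

theorem exists_apply_prod_eq_sub_mul {E : Type*} [AddCommGroup E] [Module ℝ E] [TopologicalSpace E]
    (g : StrongDual ℝ (E × ℝ)) :
    ∃ (v : StrongDual ℝ E) (a : ℝ), ∀ p, g p = v p.1 - a * p.2 := by
  refine ⟨g.comp (.inl ℝ E ℝ), -g (0, 1), fun ⟨e, r⟩ => ?_⟩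
  have hdecomp : ((e, r) : E × ℝ) = (e, 0) + r • (0, 1) := by simp
  rw [hdecomp, map_add, map_smul]
  simp [mul_comm]

theorem IsReflexiveSpace.exists_apply_eq_sub_mul (hX : IsReflexiveSpace X)
    (g : StrongDual ℝ (StrongDual ℝ X × ℝ)) :
    ∃ (u : X) (a : ℝ), ∀ q, g q = q.1 u - a * q.2 := by
  obtain ⟨w, a, hg⟩ := exists_apply_prod_eq_sub_mul g
  obtain ⟨u, rfl⟩ := hX w
  exact ⟨u, a, hg⟩

/-- The pair `(0, 1)` stands for the trivial inequality `0 ≤ 1`, without which the cone would miss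
the consequences obtained by enlarging a right-hand side. -/
theorem IsReflexiveSpace.mem_closure_hull_insert_zero_one_iff
    (hX : IsReflexiveSpace X) {G : Set (StrongDual ℝ X × ℝ)} {d₀ : X}
    (hd₀ : ∀ q ∈ G, q.1 d₀ ≤ q.2) {v : StrongDual ℝ X} {δ : ℝ} :
    (v, δ) ∈ closure (hull ℝ (insert (0, 1) G) : Set (StrongDual ℝ X × ℝ)) ↔
      ∀ d, (∀ q ∈ G, q.1 d ≤ q.2) → v d ≤ δ := by
  rw [mem_closure_hull_iff_forall_le_zero]
  constructor
  · intro h d hd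
    let g : StrongDual ℝ (StrongDual ℝ X × ℝ) :=
      (NormedSpace.inclusionInDoubleDual ℝ X d).comp (.fst ℝ _ ℝ) - .snd ℝ _ ℝ
    have hg : ∀ q ∈ insert (0, 1) G, g q ≤ 0 :=
      Set.forall_mem_insert.2 ⟨by simp [g], fun q hq => sub_nonpos.2 (hd q hq)⟩
    exact sub_nonpos.1 (h g hg)
  · intro h g hg
    obtain ⟨u, a, hua⟩ := hX.exists_apply_eq_sub_mul g
    simp only [hua] at hg ⊢
    have ha : 0 ≤ a := by simpa using hg (0, 1) (Set.mem_insert _ _)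
    by_contra! hpos
    -- Moving slightly towards `d₀` makes the coefficient of the right-hand sides positive.
    obtain ⟨η, hη, hsmall⟩ := exists_pos_mul_lt hpos (δ - v d₀)
    have haη : 0 < a + η := by positivity
    have hsol : ∀ w : StrongDual ℝ X, ∀ r : ℝ,
        w ((a + η)⁻¹ • (u + η • d₀)) ≤ r ↔ w u + η * w d₀ ≤ (a + η) * r := fun w r => by
      rw [map_smul, map_add, map_smul, smul_eq_mul, smul_eq_mul, inv_mul_le_iff₀ haη]
    have hv := h _ fun q hq => (hsol q.1 q.2).2 <| by
      linarith [hg q (Set.mem_insert_of_mem _ hq), mul_le_mul_of_nonneg_left (hd₀ q hq) hη.le]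
    rw [hsol] at hv
    linarith

end Farkas

section FenchelMoreau

variable {X : Type*} [NormedAddCommGroup X] [NormedSpace ℝ X] {f : X → EReal}
  {v : StrongDual ℝ X} {s : ℝ}

/-- The continuous affine function `v - s` minorizes `f`. The set of such pairs `(v, s)` is the
epigraph of the conjugate of `f`. -/
def IsAffineMinorant (f : X → EReal) (v : StrongDual ℝ X) (s : ℝ) : Prop :=
  ∀ u, ((v u - s : ℝ) : EReal) ≤ f u

theorem IsAffineMinorant.mono (h : IsAffineMinorant f v s) {s' : ℝ} (hs : s ≤ s') :
    IsAffineMinorant f v s' :=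
  fun u => (EReal.coe_le_coe_iff.2 (sub_le_sub_left hs (v u))).trans (h u)

theorem isAffineMinorant_iff_forall_mem_epi :
    IsAffineMinorant f v s ↔ ∀ p ∈ epi f, v p.1 - p.2 ≤ s := by
  constructor
  · intro h p hp
    have hle : v p.1 - s ≤ p.2 := EReal.coe_le_coe_iff.1 ((h p.1).trans hp)
    linarith
  · intro h u
    refine EReal.le_of_forall_lt_iff_le.1 fun r hr => EReal.coe_le_coe_iff.2 ?_
    linarith [h (u, r) hr.le]

theorem isAffineMinorant_inv_smul_iff {a c : ℝ} (ha : 0 < a) :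
    IsAffineMinorant f (a⁻¹ • v) (a⁻¹ * c) ↔ ∀ p ∈ epi f, v p.1 - a * p.2 ≤ c := by
  rw [isAffineMinorant_iff_forall_mem_epi]
  refine forall₂_congr fun p _ => ?_
  rw [smul_apply, smul_eq_mul, ← mul_le_mul_iff_right₀ ha, mul_sub, mul_inv_cancel_left₀ ha.ne',
    mul_inv_cancel_left₀ ha.ne']

theorem IsGammaZero.exists_separation (hf : IsGammaZero f) {y : X} {r : ℝ} (h : (r : EReal) < f y) :
    ∃ (v : StrongDual ℝ X) (a c : ℝ), 0 ≤ a ∧ c < v y - a * r ∧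
      ∀ p ∈ epi f, v p.1 - a * p.2 < c := by
  obtain ⟨g, c, hg, hc⟩ := geometric_hahn_banach_closed_point hf.convex hf.lsc
    (show (y, r) ∉ epi f from not_le.2 h)
  obtain ⟨v, a, hva⟩ := exists_apply_prod_eq_sub_mul g
  simp only [hva] at hg hc
  refine ⟨v, a, c, ?_, hc, hg⟩
  by_contra! ha
  obtain ⟨x₀, hx₀⟩ := hf.proper
  obtain ⟨n, hn⟩ := exists_nat_gt ((c - v x₀) / -a)
  rw [div_lt_iff₀ (neg_pos.2 ha)] at hn
  have hmem : (x₀, max (f x₀).toReal n) ∈ epi f :=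
    (EReal.le_coe_toReal hx₀.ne).trans (EReal.coe_le_coe_iff.2 (le_max_left _ _))
  linarith [hg _ hmem,
    mul_le_mul_of_nonneg_left (le_max_right (f x₀).toReal (n : ℝ)) (neg_pos.2 ha).le]

theorem IsGammaZero.exists_isAffineMinorant (hf : IsGammaZero f) :
    ∃ v s, IsAffineMinorant f v s := by
  obtain ⟨x₀, hx₀⟩ := hf.proper
  have hcoe : ((f x₀).toReal : EReal) = f x₀ := EReal.coe_toReal hx₀.ne (hf.ne_bot x₀)
  have hlt : (((f x₀).toReal - 1 : ℝ) : EReal) < f x₀ := by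
    conv_rhs => rw [← hcoe]
    exact EReal.coe_lt_coe_iff.2 (sub_one_lt _)
  obtain ⟨v, a, c, -, hc, hepi⟩ := hf.exists_separation hlt
  have ha : 0 < a := by linarith [hepi (x₀, (f x₀).toReal) hcoe.ge]
  exact ⟨_, _, (isAffineMinorant_inv_smul_iff ha).2 fun p hp => (hepi p hp).le⟩

theorem IsGammaZero.le_coe_iff_forall_isAffineMinorant (hf : IsGammaZero f) {y : X} {r : ℝ} :
    f y ≤ r ↔ ∀ v s, IsAffineMinorant f v s → v y - s ≤ r := by
  refine ⟨fun hy v s h => EReal.coe_le_coe_iff.1 ((h y).trans hy), fun h => ?_⟩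
  by_contra! hlt
  obtain ⟨v, a, c, ha, hc, hepi⟩ := hf.exists_separation hlt
  obtain ⟨w, b, hw⟩ := hf.exists_isAffineMinorant
  -- Adding a small multiple of a minorant makes a possibly vertical hyperplane non-vertical.
  obtain ⟨η, hη, hsmall⟩ := exists_pos_mul_lt (sub_pos.2 hc) (r - (w y - b))
  have haη : 0 < a + η := by positivity
  have hmin : IsAffineMinorant f ((a + η)⁻¹ • (v + η • w)) ((a + η)⁻¹ * (c + η * b)) := by
    refine (isAffineMinorant_inv_smul_iff haη).2 fun p hp => ?_
    have hwp := mul_le_mul_of_nonneg_left (isAffineMinorant_iff_forall_mem_epi.1 hw p hp) hη.le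
    rw [add_apply, smul_apply, smul_eq_mul]
    linarith [hepi p hp]
  have hy := h _ _ hmin
  rw [smul_apply, add_apply, smul_apply, smul_eq_mul, smul_eq_mul, ← mul_sub,
    inv_mul_le_iff₀ haη] at hy
  linarith

theorem mem_epsSubdiff_iff_isAffineMinorant {x : X} (hbot : f x ≠ ⊥) (htop : f x ≠ ⊤) {ε : ℝ} :
    v ∈ epsSubdiff ε f x ↔ IsAffineMinorant f v (v x - (f x).toReal + ε) := by
  obtain ⟨a, ha⟩ : ∃ a : ℝ, f x = a := ⟨_, (EReal.coe_toReal htop hbot).symm⟩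
  have hiff : ∀ u, ((v (u - x) : ℝ) : EReal) ≤ f u - f x + (ε : EReal) ↔
      ((v u - (v x - (f x).toReal + ε) : ℝ) : EReal) ≤ f u := by
    intro u
    rw [ha, map_sub, EReal.toReal_coe]
    induction f u with
    | bot => simp [sub_eq_add_neg]
    | top => simp
    | coe b =>
      norm_cast
      constructor <;> intro h <;> linarith
  refine ⟨fun h u => (hiff u).1 (h.2.2 u), fun h => ⟨?_, htop.lt_top, fun u => (hiff u).2 (h u)⟩⟩
  have hx := h x
  rw [ha, EReal.toReal_coe, EReal.coe_le_coe_iff] at hx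
  linarith

end FenchelMoreau

section SlackSubgradients

variable {X T : Type*} [NormedAddCommGroup X] [NormedSpace ℝ X] {Φ : T → X → EReal} {x : X}

/-- The pairs of a subgradient `v ∈ ∂_ε Φ_t(x)` and its slack `Φ(x) - Φ_t(x) + ε`, where
`Φ = sup_t Φ_t`; they generate the cone of the pairs of an element of `p.subdiffSum Φ x` and the
weight of `p`. As in `Param.weight`, `toReal` is the actual value where `Φ` is finite. -/
def slackSubgradients (Φ : T → X → EReal) (x : X) : Set (StrongDual ℝ X × ℝ) :=
  {q | ∃ t ε, q.1 ∈ epsSubdiff ε (Φ t) x ∧ (⨆ t, Φ t x).toReal - (Φ t x).toReal + ε = q.2}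

theorem exists_param_of_mem_hull_slackSubgradients (hne : (slackSubgradients Φ x).Nonempty)
    {q : StrongDual ℝ X × ℝ} (hq : q ∈ hull ℝ (slackSubgradients Φ x)) :
    ∃ p : Param T, q.1 ∈ p.subdiffSum Φ x ∧ p.weight Φ x = q.2 := by
  obtain ⟨n, μ, g, hμ, hg, rfl⟩ := exists_fin_succ_of_mem_hull hne hq
  choose t ε hsub hslack using hg
  refine ⟨⟨n + 1, n.succ_pos, t, μ, ε, hμ, fun i => (hsub i).1⟩, ?_, ?_⟩
  · rw [Prod.fst_sum]
    exact Set.finsetSum_mem_finsetSum _ _ _ fun i _ => Set.smul_mem_smul_set (hsub i)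
  · simp [Param.weight, hslack, Prod.snd_sum]

theorem mem_hull_slackSubgradients_of_param {p : Param T} {v : StrongDual ℝ X}
    (hv : v ∈ p.subdiffSum Φ x) : (v, p.weight Φ x) ∈ hull ℝ (slackSubgradients Φ x) := by
  obtain ⟨z, hz, rfl⟩ := (Set.mem_fintype_sum _ _).1 hv
  choose w hw hwz using fun i => Set.mem_smul_set.1 (hz i)
  have hsum : (∑ i, z i, p.weight Φ x) = ∑ i, p.μ i •
      (w i, (⨆ t, Φ t x).toReal - (Φ (p.t i) x).toReal + p.ε i) := by
    ext1 <;> simp [Param.weight, hwz, Prod.fst_sum, Prod.snd_sum]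
  rw [hsum]
  exact Submodule.sum_mem _ fun i _ =>
    (hull ℝ _).smul_mem (p.μ_nonneg i) (subset_hull ⟨p.t i, p.ε i, hw i, rfl⟩)

theorem coe_hull_slackSubgradients_eq (hne : (slackSubgradients Φ x).Nonempty) :
    (hull ℝ (slackSubgradients Φ x) : Set (StrongDual ℝ X × ℝ)) =
      {q | ∃ p : Param T, q.1 ∈ p.subdiffSum Φ x ∧ p.weight Φ x = q.2} := by
  ext q
  refine ⟨exists_param_of_mem_hull_slackSubgradients hne, ?_⟩
  obtain ⟨v, w⟩ := q
  rintro ⟨p, hv, rfl⟩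
  exact mem_hull_slackSubgradients_of_param hv

theorem mem_slackSubgradients_iff (hbot : ∀ t, Φ t x ≠ ⊥) (htop : ⨆ t, Φ t x ≠ ⊤)
    {q : StrongDual ℝ X × ℝ} :
    q ∈ slackSubgradients Φ x ↔
      ∃ t, IsAffineMinorant (Φ t) q.1 (q.1 x - (⨆ t, Φ t x).toReal + q.2) := by
  refine exists_congr fun t => ?_
  have htop' : Φ t x ≠ ⊤ := ne_top_of_le_ne_top htop (le_iSup (fun t => Φ t x) t)
  simp only [mem_epsSubdiff_iff_isAffineMinorant (hbot t) htop']
  constructor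
  · rintro ⟨ε, hε, hq⟩
    convert hε using 1
    rw [← hq]
    ring
  · intro h
    refine ⟨q.2 - (⨆ t, Φ t x).toReal + (Φ t x).toReal, ?_, by ring⟩
    convert h using 1
    ring

variable [Nonempty T]

theorem slackSubgradients_nonempty (hΦ : ∀ t, IsGammaZero (Φ t)) (htop : ⨆ t, Φ t x ≠ ⊤) :
    (slackSubgradients Φ x).Nonempty := by
  obtain ⟨t⟩ := ‹Nonempty T›
  obtain ⟨v, s, hvs⟩ := (hΦ t).exists_isAffineMinorant
  refine ⟨(v, s - v x + (⨆ t, Φ t x).toReal),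
    (mem_slackSubgradients_iff (fun t => (hΦ t).ne_bot x) htop).2 ⟨t, ?_⟩⟩
  convert hvs using 1
  ring

theorem zero_one_mem_closure_hull_slackSubgradients (hΦ : ∀ t, IsGammaZero (Φ t))
    (htop : ⨆ t, Φ t x ≠ ⊤) :
    (0, 1) ∈ closure (hull ℝ (slackSubgradients Φ x) : Set (StrongDual ℝ X × ℝ)) := by
  obtain ⟨q, hq⟩ := slackSubgradients_nonempty hΦ htop
  have hmem := fun q => mem_slackSubgradients_iff (fun t => (hΦ t).ne_bot x) htop (q := q)
  obtain ⟨t, ht⟩ := (hmem q).1 hq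
  refine mem_closure_hull_of_forall_add_nsmul_mem (x := q) fun n => (hmem _).2 ⟨t, ?_⟩
  simpa using ht.mono (by simp : _ ≤ q.1 x - (⨆ t, Φ t x).toReal + (q.2 + n))

theorem mem_sublevel_iff_forall_slackSubgradients (hΦ : ∀ t, IsGammaZero (Φ t))
    (htop : ⨆ t, Φ t x ≠ ⊤) {u : X} :
    u ∈ sublevel (fun y => ⨆ t, Φ t y) (⨆ t, Φ t x) ↔
      ∀ q ∈ slackSubgradients Φ x, q.1 (u - x) ≤ q.2 := by
  have hbot : ⨆ t, Φ t x ≠ ⊥ := fun h =>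
    (hΦ (Classical.arbitrary T)).ne_bot x (iSup_eq_bot.1 h _)
  have hmem := fun q => mem_slackSubgradients_iff (fun t => (hΦ t).ne_bot x) htop (q := q)
  change ⨆ t, Φ t u ≤ _ ↔ _
  generalize hm : (⨆ t, Φ t x).toReal = m at hmem
  rw [← EReal.coe_toReal htop hbot, hm, iSup_le_iff]
  simp only [(hΦ _).le_coe_iff_forall_isAffineMinorant, hmem, map_sub]
  constructor
  · rintro h q ⟨t, ht⟩
    linarith [h t _ _ ht]
  · intro h t v s hvs
    have hq := h (v, s - v x + m) ⟨t, by convert hvs using 1; ring⟩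
    linarith

theorem mem_normalSet_sublevel_iff (hX : IsReflexiveSpace X) (hΦ : ∀ t, IsGammaZero (Φ t))
    (htop : ⨆ t, Φ t x ≠ ⊤) {δ : ℝ} {v : StrongDual ℝ X} :
    v ∈ normalSet δ (sublevel (fun y => ⨆ t, Φ t y) (⨆ t, Φ t x)) x ↔
      (v, δ) ∈ closure (hull ℝ (slackSubgradients Φ x) : Set (StrongDual ℝ X × ℝ)) := by
  have hsublevel := fun u => mem_sublevel_iff_forall_slackSubgradients hΦ htop (u := u)
  have hzero : ∀ q ∈ slackSubgradients Φ x, q.1 0 ≤ q.2 := by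
    simpa only [sub_self] using (hsublevel x).1 (le_refl (⨆ t, Φ t x))
  rw [← closure_hull_insert_eq (zero_one_mem_closure_hull_slackSubgradients hΦ htop),
    hX.mem_closure_hull_insert_zero_one_iff hzero, ← (Equiv.subRight x).forall_congr_right]
  exact forall_congr' fun u => imp_congr_left (hsublevel u)

end SlackSubgradients

end ConvexSublevel

/-- The topology on `StrongDual ℝ X` in `upperLimit` is that of the dual norm; the filter
`comap (weight) (𝓝 δ)` expresses `∑ᵢ μᵢ (Φ(x̄) - Φ_{tᵢ}(x̄) + εᵢ) → δ`. -/
theorem corollary3p8 {X : Type*} [NormedAddCommGroup X] [NormedSpace ℝ X] [CompleteSpace X]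
    (hX : ConvexSublevel.IsReflexiveSpace X)
    {T : Type*} [Nonempty T] (Φ : T → X → EReal)
    (hΦ : ∀ t, ConvexSublevel.IsGammaZero (Φ t))
    (xbar : X) (hxbar : xbar ∈ ConvexSublevel.effDom (fun x => ⨆ t, Φ t x))
    (δ : ℝ) (hδ : 0 ≤ δ) :
    ConvexSublevel.normalSet δ
        (ConvexSublevel.sublevel (fun x => ⨆ t, Φ t x) (⨆ t, Φ t xbar)) xbar =
      ConvexSublevel.upperLimit
        (Filter.comap (ConvexSublevel.Param.weight Φ xbar) (𝓝 δ))
        (ConvexSublevel.Param.subdiffSum Φ xbar) := by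
  have htop : ⨆ t, Φ t xbar ≠ ⊤ := ne_of_lt hxbar
  ext v
  rw [ConvexSublevel.mem_normalSet_sublevel_iff hX hΦ htop,
    ConvexSublevel.mem_upperLimit_comap_nhds,
    ConvexSublevel.coe_hull_slackSubgradients_eq
      (ConvexSublevel.slackSubgradients_nonempty hΦ htop)]
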